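/- A dissimilarity on a finite set \(X\) is a (not necessarily symmetric) function \(d\colon X\times X\to\mathbb{R}_{\ge 0}\) with \(d(x,x)=0\) for all \(x\in X\). The dissimilarity space \((X,d)\) is two-way-Robinson if the elements of \(X\) can be listed, each exactly once, as \(p_1,\dots,p_n\) (the vertices of a directed path, in order) such that, for all \(i<j<k\), \[ d(p_i,p_k)\ge\max\{d(p_i,p_j),d(p_j,p_k)\}\quad\text{and}\quad d(p_k,p_i)\ge\max\{d(p_k,p_j),d(p_j,p_i)\}. \] It can be decided in time \(O(|X|^3)\) whether a given dissimilarity space \((X,d)\) is two-way-Robinson. Precisely: there are a single program \(\mathcal{P}\) for a random access machine and constants \(w, C\in\mathbb{N}\) such that, for every finite set \(X\), with \(n=|X|\), every dissimilarity \(d\) on \(X\) and every enumeration \(x_0,\dots,x_{n-1}\) of \(X\), the program \(\mathcal{P}\), started with \(n\) and the matrix \((d(x_i,x_j))_{0\le i,j<n}\) as input, halts after at most \(C(n^3+1)\) elementary operations, with the answer \(1\) if \((X,d)\) is two-way-Robinson and \(0\) otherwise. Here the machine works on words of \(O(\log n)\) bits, namely natural numbers below \((n+2)^{w+1}\), which it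 keeps in finitely many variables and arrays named by the program and initially \(0\) (except for the variable that holds \(n\)); addition and multiplication modulo \((n+2)^{w+1}\), truncated subtraction, comparison of words, reading and writing of variables and array cells, and Boolean operations and branching each count as one elementary operation; and the real entries of the input matrix are accessed only by comparisons \(d(x_i,x_j)\le d(x_k,x_l)\), each of which counts as one elementary operation. -/

import Mathlib

/-! ### Dissimilarity spaces -/

/-- A (not necessarily symmetric) dissimilarity on `X`: a nonnegative real function of two
variables which vanishes on the diagonal. -/
structure IsDissimilarity {X : Type*} (d : X → X → ℝ) : Prop where
  nonneg : ∀ x y, 0 ≤ d x y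
  self : ∀ x, d x x = 0

/-- `(X, d)` is two-way-Robinson if the elements of `X` can be listed as `p 0, …, p (n - 1)`
(each exactly once), i.e. arranged along a directed path, in such a way that the inequalities
below hold, in both directions of the path, for any three positions `i < j < k`. -/
def IsTwoWayRobinson {X : Type*} [Fintype X] (d : X → X → ℝ) : Prop :=
  ∃ p : Fin (Fintype.card X) ≃ X, ∀ i j k : Fin (Fintype.card X), i < j → j < k →
    max (d (p i) (p j)) (d (p j) (p k)) ≤ d (p i) (p k) ∧
    max (d (p k) (p j)) (d (p j) (p i)) ≤ d (p k) (p i)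

/-! ### A random access machine with a step count

The machine has finitely many word variables and finitely many arrays of words (those that the
program names). A word is a natural number below a bound `W`, and arithmetic is modulo `W`.
For inputs of size `n` we shall take `W = (n + 2) ^ (w + 1)`, with `w` a constant of the program,
so that a word has `O(log n)` bits. The real entries of the input matrix are available only
through comparisons of two entries, each at unit cost. -/

namespace RAM

/-- Word expressions. -/
inductive Term : Type
  | const (k : ℕ)
  | var (x : ℕ)
  | read (a : ℕ) (i : Term)
  | add (u v : Term)
  | sub (u v : Term)
  | mul (u v : Term)

/-- Tests: `le u v` compares two words, `entryLe i j k l` asks whether the input entry at row `i`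
and column `j` is at most the one at row `k` and column `l`. -/
inductive Test : Type
  | le (u v : Term)
  | entryLe (i j k l : Term)
  | not (b : Test)
  | and (b c : Test)

/-- Programs: `assign x u` stores `u` in the variable `x`, and `write a i u` stores `u` in the
cell `i` of the array `a`. -/
inductive Program : Type
  | skip
  | assign (x : ℕ) (u : Term)
  | write (a : ℕ) (i u : Term)
  | seq (p q : Program)
  | ite (b : Test) (p q : Program)
  | loop (b : Test) (p : Program)

/-- The contents of the variables and of the arrays. -/
structure State : Type where
  var : ℕ → ℕ
  arr : ℕ → ℕ → ℕ

/-- The value of a word expression; subtraction is truncated at `0`. -/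
def Term.eval (W : ℕ) (s : State) : Term → ℕ
  | const k => k % W
  | var x => s.var x
  | read a i => s.arr a (i.eval W s)
  | add u v => (u.eval W s + v.eval W s) % W
  | sub u v => u.eval W s - v.eval W s
  | mul u v => (u.eval W s * v.eval W s) % W

/-- The number of elementary operations in the evaluation of a word expression. -/
def Term.cost : Term → ℕ
  | const _ => 1
  | var _ => 1
  | read _ i => i.cost + 1
  | add u v => u.cost + v.cost + 1
  | sub u v => u.cost + v.cost + 1
  | mul u v => u.cost + v.cost + 1

/-- The truth of a test, for the input matrix `D`. A comparison of entries with an index out of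
range counts as false. -/
def Test.Holds (W : ℕ) {n : ℕ} (D : Fin n → Fin n → ℝ) (s : State) : Test → Prop
  | le u v => u.eval W s ≤ v.eval W s
  | entryLe i j k l => ∃ i' j' k' l' : Fin n,
      i.eval W s = i' ∧ j.eval W s = j' ∧ k.eval W s = k' ∧ l.eval W s = l' ∧ D i' j' ≤ D k' l'
  | not b => ¬ b.Holds W D s
  | and b c => b.Holds W D s ∧ c.Holds W D s

/-- The number of elementary operations in the evaluation of a test. -/
def Test.cost : Test → ℕ
  | le u v => u.cost + v.cost + 1
  | entryLe i j k l => i.cost + j.cost + k.cost + l.cost + 1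
  | not b => b.cost + 1
  | and b c => b.cost + c.cost + 1

/-- `Exec W D p s t s'`: on the input matrix `D`, with word bound `W`, the program `p` started in
the state `s` halts after exactly `t` elementary operations, in the state `s'`. -/
inductive Exec (W : ℕ) {n : ℕ} (D : Fin n → Fin n → ℝ) : Program → State → ℕ → State → Prop
  | skip (s : State) : Exec W D .skip s 1 s
  | assign (x : ℕ) (u : Term) (s : State) :
      Exec W D (.assign x u) s (u.cost + 1) ⟨Function.update s.var x (u.eval W s), s.arr⟩
  | write (a : ℕ) (i u : Term) (s : State) :
      Exec W D (.write a i u) s (i.cost + u.cost + 1)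
        ⟨s.var, Function.update s.arr a (Function.update (s.arr a) (i.eval W s) (u.eval W s))⟩
  | seq {p q : Program} {s s₁ s₂ : State} {t₁ t₂ : ℕ} :
      Exec W D p s t₁ s₁ → Exec W D q s₁ t₂ s₂ → Exec W D (.seq p q) s (t₁ + t₂) s₂
  | iteTrue {b : Test} {p q : Program} {s s₁ : State} {t : ℕ} :
      b.Holds W D s → Exec W D p s t s₁ → Exec W D (.ite b p q) s (b.cost + t + 1) s₁
  | iteFalse {b : Test} {p q : Program} {s s₁ : State} {t : ℕ} :
      ¬ b.Holds W D s → Exec W D q s t s₁ → Exec W D (.ite b p q) s (b.cost + t + 1) s₁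
  | loopTrue {b : Test} {p : Program} {s s₁ s₂ : State} {t₁ t₂ : ℕ} :
      b.Holds W D s → Exec W D p s t₁ s₁ → Exec W D (.loop b p) s₁ t₂ s₂ →
        Exec W D (.loop b p) s (b.cost + t₁ + t₂ + 1) s₂
  | loopFalse {b : Test} {p : Program} {s : State} :
      ¬ b.Holds W D s → Exec W D (.loop b p) s (b.cost + 1) s

/-- The machine is deterministic: the running time and the final state are unique. -/
theorem Exec.unique {W n : ℕ} {D : Fin n → Fin n → ℝ} {p : Program} {s s₁ s₂ : State} {t₁ t₂ : ℕ}
    (h₁ : Exec W D p s t₁ s₁) (h₂ : Exec W D p s t₂ s₂) : t₁ = t₂ ∧ s₁ = s₂ := by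
  induction h₁ generalizing t₂ s₂ with
  | skip s => cases h₂; exact ⟨rfl, rfl⟩
  | assign x u s => cases h₂; exact ⟨rfl, rfl⟩
  | write a i u s => cases h₂; exact ⟨rfl, rfl⟩
  | seq _ _ ih₁ ih₂ =>
    cases h₂ with
    | seq g₁ g₂ =>
      obtain ⟨rfl, rfl⟩ := ih₁ g₁
      obtain ⟨rfl, rfl⟩ := ih₂ g₂
      exact ⟨rfl, rfl⟩
  | iteTrue hb _ ih =>
    cases h₂ with
    | iteTrue _ g => obtain ⟨rfl, rfl⟩ := ih g; exact ⟨rfl, rfl⟩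
    | iteFalse hb' _ => exact absurd hb hb'
  | iteFalse hb _ ih =>
    cases h₂ with
    | iteTrue hb' _ => exact absurd hb' hb
    | iteFalse _ g => obtain ⟨rfl, rfl⟩ := ih g; exact ⟨rfl, rfl⟩
  | loopTrue hb _ _ ih₁ ih₂ =>
    cases h₂ with
    | loopTrue _ g₁ g₂ =>
      obtain ⟨rfl, rfl⟩ := ih₁ g₁
      obtain ⟨rfl, rfl⟩ := ih₂ g₂
      exact ⟨rfl, rfl⟩
    | loopFalse hb' => exact absurd hb hb'
  | loopFalse hb =>
    cases h₂ with
    | loopTrue hb' _ _ => exact absurd hb' hb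
    | loopFalse _ => exact ⟨rfl, rfl⟩

/-- The initial state for an input of size `n`: the variable `0` holds `n`, and all the other
variables and all the array cells hold `0`. -/
def initialState (n : ℕ) : State where
  var := Function.update (fun _ => 0) 0 n
  arr := fun _ _ => 0

/-- On the input matrix `D` of size `n`, with words below `(n + 2) ^ (w + 1)`, the program `p`
halts after at most `T` elementary operations and its answer, the final value of the variable `0`,
is `1` if `P` is true and `0` if `P` is false. -/
def DecidesWithin (p : Program) (w : ℕ) {n : ℕ} (D : Fin n → Fin n → ℝ) (T : ℕ) (P : Prop) : Prop :=
  ∃ (t : ℕ) (s : State), Exec ((n + 2) ^ (w + 1)) D p (initialState n) t s ∧ t ≤ T ∧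
    (P → s.var 0 = 1) ∧ (¬ P → s.var 0 = 0)

end RAM

/-! ### Classes of ordered pairs -/

/-! An admissible listing is a strict linear order in which no `x` lies between `y` and `z` when
`SameSide d x y z`; equivalently, `(x, y)` and `(x, z)` are oriented alike. Orientations are
therefore forced along classes of ordered pairs, and a class containing both `(x, y)` and `(y, x)`
with `x ≠ y` is an obstruction.

It is the only one, as in Gallai's theory of implication classes. In its absence, classes come in
opposite pairs; from each, keep the one with the lexicographically smaller least member
(`Precedes`). A triangle lemma (`PairEquiv.triangle`) says that a vertex sees all members of a class
alike unless the class reaches it; descent on the least members then excludes cyclic triangles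
(`Precedes.acyclic`). The result is a strict linear order, constant on classes, hence admissible:
this is `isTwoWayRobinson_iff_pairEquiv`.

Classes are the connected components of a graph on `n²` ordered pairs with at most `2 * n`
neighbours each, so breadth-first search labels them in cubic time. The invariant `Valid` carries
its correctness, and a potential counting unprocessed pairs and unscanned cells carries its running
time. A quadratic pass then compares each label with that of the reversed pair. -/

/-- `y` and `z` have to lie on the same side of `x` in every admissible order: one of the four
inequalities that allow `x` to be between `y` and `z` fails. -/
def SameSide {V : Type*} (d : V → V → ℝ) (x y z : V) : Prop :=
  ¬ (((d y x ≤ d y z ∧ d x y ≤ d z y) ∧ d z x ≤ d z y) ∧ d x z ≤ d y z)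

/-- Elementary step between ordered pairs that are oriented alike in every admissible order. -/
inductive PairStep {V : Type*} (d : V → V → ℝ) : V × V → V × V → Prop
  | right {x y z : V} : SameSide d x y z → PairStep d (x, y) (x, z)
  | left {x y z : V} : SameSide d x y z → PairStep d (y, x) (z, x)

/-- The equivalence relation generated by the elementary steps. -/
abbrev PairEquiv {V : Type*} (d : V → V → ℝ) : V × V → V × V → Prop :=
  Relation.ReflTransGen (PairStep d)

section Pairs

variable {V : Type*} {d : V → V → ℝ}

theorem SameSide.symm {x y z : V} (h : SameSide d x y z) : SameSide d x z y := by
  unfold SameSide at *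
  tauto

theorem PairStep.symm {p q : V × V} (h : PairStep d p q) : PairStep d q p := by
  cases h with
  | right h => exact .right h.symm
  | left h => exact .left h.symm

theorem PairStep.swap {p q : V × V} (h : PairStep d p q) : PairStep d p.swap q.swap := by
  cases h with
  | right h => exact .left h
  | left h => exact .right h

theorem PairEquiv.symm {p q : V × V} (h : PairEquiv d p q) : PairEquiv d q p :=
  by
  induction h with
  | refl => exact .refl
  | tail _ hq ih => exact .head hq.symm ih

theorem PairEquiv.swap {p q : V × V} (h : PairEquiv d p q) : PairEquiv d p.swap q.swap :=
  by
  induction h with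
  | refl => exact .refl
  | tail _ hq ih => exact ih.tail hq.swap

/-- Betweenness composes: if `a` may lie between `b` and `b'`, and `c` both between `b` and `a` and
between `b'` and `a`, then `c` may lie between `b` and `b'`. Hence if `a` may lie between `b` and
`b'`, one of the two conditions on `c` fails, which links `(c, a)` to `(c, b)` directly or through
`(c, b')`. -/
theorem SameSide.equiv_or {c b b' : V} (h : SameSide d c b b') (a : V) :
    PairEquiv d (c, b) (c, a) ∨ SameSide d a b b' := by
  by_cases ha : SameSide d a b b'
  · exact .inr ha
  left
  by_cases h₁ : SameSide d c b a
  · exact .single (.right h₁)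
  refine .trans (.single (.right h)) (.single (.right ?_))
  unfold SameSide at *
  simp only [not_not] at h₁ ha
  obtain ⟨⟨⟨_, _⟩, _⟩, _⟩ := ha
  obtain ⟨⟨⟨_, _⟩, _⟩, _⟩ := h₁
  rintro ⟨⟨⟨_, _⟩, _⟩, _⟩
  apply h
  refine ⟨⟨⟨?_, ?_⟩, ?_⟩, ?_⟩ <;> linarith

/-- If the class of `(b, c)` contains neither `(b, a)` nor `(a, c)`, then `a` is related in the
same way to all members of the class. -/
theorem PairEquiv.triangle {a b c b' c' : V} (h₁ : ¬ PairEquiv d (c, b) (c, a))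
    (h₂ : ¬ PairEquiv d (b, c) (b, a)) (h : PairEquiv d (b, c) (b', c')) :
    PairEquiv d (a, b) (a, b') ∧ PairEquiv d (a, c) (a, c') := by
  suffices ∀ p, PairEquiv d (b, c) p →
      PairEquiv d (a, b) (a, p.1) ∧ PairEquiv d (a, c) (a, p.2) from this _ h
  intro p hp
  induction hp with
  | refl => exact ⟨.refl, .refl⟩
  | @tail p q hp hq ih =>
    obtain ⟨ih₁, ih₂⟩ := ih
    cases hq with
    | @right x y z hq =>
      refine ⟨ih₁, ?_⟩
      rcases hq.equiv_or a with h | h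
      -- Here the class of `(b, c)` would contain `(x, a)`, hence `(b, a)`, because `ih₁` relates
      -- `(a, b)` to `(a, x)`.
      · exact absurd ((hp.trans h).trans (PairEquiv.symm ih₁).swap) h₂
      · exact ih₂.tail (.right h)
    | @left x y z hq =>
      refine ⟨?_, ih₂⟩
      rcases hq.equiv_or a with h | h
      · exact absurd (((PairEquiv.swap hp).trans h).trans (PairEquiv.symm ih₂).swap) h₁
      · exact ih₁.tail (.right h)

/-- The class of `(x, y)` precedes the class of `(y, x)`, when classes are compared by their
lexicographically smallest members. -/
def Precedes [LinearOrder V] (d : V → V → ℝ) (x y : V) : Prop :=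
  ∃ p, PairEquiv d (x, y) p ∧ ∀ q, PairEquiv d (y, x) q → toLex p < toLex q

theorem Precedes.congr [LinearOrder V] {x y x' y' : V} (h : Precedes d x y)
    (e : PairEquiv d (x, y) (x', y')) : Precedes d x' y' := by
  obtain ⟨p, hp, hq⟩ := h
  exact ⟨p, e.symm.trans hp, fun q h => hq q (e.swap.trans h)⟩

theorem Precedes.asymm [LinearOrder V] {x y : V} (h : Precedes d x y) : ¬ Precedes d y x := by
  rintro ⟨q, hq, hq'⟩
  obtain ⟨p, hp, hp'⟩ := h
  exact lt_asymm (hp' q hq) (hq' p hp)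

theorem Precedes.total [LinearOrder V] [Finite V] {x y : V} (h : ¬ PairEquiv d (x, y) (y, x)) :
    Precedes d x y ∨ Precedes d y x := by
  have hmin : ∀ r : V × V, ∃ p, PairEquiv d r p ∧ ∀ q, PairEquiv d r q → toLex p ≤ toLex q := by
    intro r
    obtain ⟨p, hp, hq⟩ := Set.exists_min_image {p | PairEquiv d r p} toLex (Set.toFinite _)
      ⟨r, .refl⟩
    exact ⟨p, hp, hq⟩
  obtain ⟨p, hp, hp'⟩ := hmin (x, y)
  obtain ⟨q, hq, hq'⟩ := hmin (y, x)
  rcases lt_trichotomy (toLex p) (toLex q) with hlt | heq | hlt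
  · exact .inl ⟨p, hp, fun r hr => hlt.trans_le (hq' r hr)⟩
  · obtain rfl : p = q := heq
    exact absurd (hp.trans hq.symm) h
  · exact .inr ⟨q, hq, fun r hr => hlt.trans_le (hp' r hr)⟩

/-- Descent on the first vertex. The least-member comparison gives `(p, q)` in the class of `(c, a)`
lexicographically below `(a, c)`, so `p ≤ a`. By the triangle lemma seen from `b`, replacing `(c,
a)` by `(p, q)` yields another cycle `p, q, b`. -/
theorem Precedes.acyclic [LinearOrder V] [WellFoundedLT V] {a b c : V} (hab : Precedes d a b)
    (hbc : Precedes d b c) (hca : Precedes d c a) : False := by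
  induction a using WellFoundedLT.induction generalizing b c with
  | _ a ih =>
    obtain ⟨⟨p, q⟩, hp, hq⟩ := id hca
    have hle : p ≤ a := (Prod.Lex.toLex_lt_toLex.1 (hq (a, c) .refl)).elim le_of_lt fun h => h.1.le
    obtain ⟨h₁, h₂⟩ := PairEquiv.triangle (a := b) (fun h => (hab.congr h.symm).asymm hca)
      (fun h => (hca.congr h).asymm hbc) hp
    rcases hle.lt_or_eq with hlt | rfl
    · exact ih p hlt (hca.congr hp) (hab.congr h₂.swap) (hbc.congr h₁)
    -- If `p = a`, then `(b, c)` and `(b, a)` are in one class, so `b` precedes both.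
    · exact hab.asymm (hbc.congr h₁)

end Pairs

/-! ### Admissible orders and classes of pairs -/

theorem isTwoWayRobinson_iff {X : Type*} [Fintype X] {d : X → X → ℝ} :
    IsTwoWayRobinson d ↔ ∃ p : Fin (Fintype.card X) ≃ X, ∀ i j k, i < j → j < k →
      ¬ SameSide d (p j) (p i) (p k) := by
  unfold IsTwoWayRobinson SameSide
  refine exists_congr fun p => forall_congr' fun i => forall_congr' fun j => forall_congr' fun k =>
    imp_congr_right fun _ => imp_congr_right fun _ => ?_
  simp only [max_le_iff, not_not]
  tauto

/-- When `x = y`, the zero diagonal and nonnegativity make all four inequalities true. -/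
theorem SameSide.ne {X : Type*} {d : X → X → ℝ} (hd : IsDissimilarity d) {x y z : X}
    (h : SameSide d x y z) : x ≠ y := by
  rintro rfl
  exact h (by simp [hd.self, hd.nonneg])

theorem SameSide.lt_iff_lt {X : Type*} {n : ℕ} {d : X → X → ℝ} (hd : IsDissimilarity d)
    {p : Fin n ≃ X} (hp : ∀ i j k, i < j → j < k → ¬ SameSide d (p j) (p i) (p k)) {x y z : X}
    (h : SameSide d x y z) : p.symm x < p.symm y ↔ p.symm x < p.symm z := by
  have key : ∀ {y z}, SameSide d x y z → p.symm x < p.symm y → p.symm x < p.symm z := by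
    intro y z h hy
    by_contra hz
    have hne : p.symm z ≠ p.symm x := fun e => h.symm.ne hd (p.symm.injective e).symm
    have := hp _ _ _ (lt_of_le_of_ne (not_lt.1 hz) hne) hy
    simp only [Equiv.apply_symm_apply] at this
    exact this h.symm
  exact ⟨key h, key h.symm⟩

theorem exists_equiv_fin_of_strictTotal {X : Type*} [Fintype X] {r : X → X → Prop}
    (hirr : ∀ x, ¬ r x x) (htrans : ∀ x y z, r x y → r y z → r x z)
    (htot : ∀ x y, x ≠ y → r x y ∨ r y x) :
    ∃ p : Fin (Fintype.card X) ≃ X, ∀ i j, i < j → r (p i) (p j) := by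
  classical
  have : IsStrictTotalOrder X r :=
    { irrefl := hirr
      trans := htrans
      trichotomous := fun x y hxy hyx => by
        by_contra hne
        exact (htot x y hne).elim hxy hyx }
  let _ : LinearOrder X := linearOrderOfSTO r
  let p : Fin (Fintype.card X) ≃o X := Fintype.orderIsoFinOfCardEq X rfl
  exact ⟨p.toEquiv, fun i j hij => p.strictMono hij⟩

/-- A listing orients every member of a class alike, so no class reverses a pair. Conversely,
`Precedes` is total without such reversals, and transitivity follows from totality and the absence
of cyclic triangles. -/
theorem isTwoWayRobinson_iff_pairEquiv {X : Type*} [Fintype X] {d : X → X → ℝ}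
    (hd : IsDissimilarity d) :
    IsTwoWayRobinson d ↔ ∀ x y, x ≠ y → ¬ PairEquiv d (x, y) (y, x) := by
  classical
  rw [isTwoWayRobinson_iff]
  constructor
  · rintro ⟨p, hp⟩ x y hxy h
    have key : ∀ q, PairEquiv d (x, y) q →
        (p.symm x < p.symm y ↔ p.symm q.1 < p.symm q.2) ∧ q.1 ≠ q.2 := by
      intro q hq
      induction hq with
      | refl => exact ⟨.rfl, hxy⟩
      | tail _ hq ih =>
        cases hq with
        | right hq => exact ⟨ih.1.trans (hq.lt_iff_lt hd hp), hq.symm.ne hd⟩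
        | left hq =>
          have h₁ := hq.lt_iff_lt hd hp
          have h₂ := (p.symm.injective.ne (hq.ne hd)).lt_or_gt
          have h₃ := (p.symm.injective.ne (hq.symm.ne hd)).lt_or_gt
          refine ⟨ih.1.trans ?_, (hq.symm.ne hd).symm⟩
          constructor <;> intro h
          · exact h₃.resolve_left fun h' => lt_asymm h (h₁.2 h')
          · exact h₂.resolve_left fun h' => lt_asymm h (h₁.1 h')
    have := (key _ h).1
    rcases (p.symm.injective.ne hxy).lt_or_gt with h | h
    · exact lt_asymm h (this.1 h)
    · exact lt_asymm h (this.2 h)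
  · intro h
    let _ : LinearOrder X := LinearOrder.lift' (Fintype.equivFin X) (Fintype.equivFin X).injective
    have htot : ∀ x y, x ≠ y → Precedes d x y ∨ Precedes d y x := fun x y hxy =>
      Precedes.total (h x y hxy)
    have hirr : ∀ x, ¬ Precedes d x x := fun x hx => hx.asymm hx
    have htrans : ∀ x y z, Precedes d x y → Precedes d y z → Precedes d x z := by
      intro x y z hxy hyz
      have hxz : x ≠ z := by rintro rfl; exact hxy.asymm hyz
      exact (htot x z hxz).resolve_right fun hzx => hxy.acyclic hyz hzx
    obtain ⟨p, hp⟩ := exists_equiv_fin_of_strictTotal hirr htrans htot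
    refine ⟨p, fun i j k hij hjk hs => ?_⟩
    -- Otherwise `p j` would precede `p i` as well as `p k`, the two pairs being one step apart.
    exact (hp i j hij).asymm ((hp j k hjk).congr (.single (.right hs.symm)))

/-! ### Transport of classes along an enumeration -/

theorem PairEquiv.map {X Y : Type*} {d : X → X → ℝ} (f : Y → X) {p q : Y × Y}
    (h : PairEquiv (fun i j => d (f i) (f j)) p q) :
    PairEquiv d (p.map f f) (q.map f f) := by
  induction h with
  | refl => exact .refl
  | tail _ hq ih =>
    refine ih.tail ?_
    cases hq with
    | right hq => exact .right hq
    | left hq => exact .left hq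

theorem pairEquiv_map_iff {X Y : Type*} {d : X → X → ℝ} (e : Y ≃ X) {p q : Y × Y} :
    PairEquiv d (p.map e e) (q.map e e) ↔ PairEquiv (fun i j => d (e i) (e j)) p q := by
  refine ⟨fun h => ?_, PairEquiv.map e⟩
  have := PairEquiv.map (d := fun i j => d (e i) (e j)) e.symm (p := p.map e e) (q := q.map e e)
    (by simpa using h)
  simpa [Prod.map_map] using this

namespace RAM

/-! ### Reasoning about runs -/

/-- The program `p`, started in `s`, halts, and its running time and final state satisfy `Q`. -/
def Runs (W : ℕ) {n : ℕ} (D : Fin n → Fin n → ℝ) (p : Program) (s : State)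
    (Q : ℕ → State → Prop) : Prop :=
  ∃ t s', Exec W D p s t s' ∧ Q t s'

section Runs

variable {W n : ℕ} {D : Fin n → Fin n → ℝ} {s : State} {Q : ℕ → State → Prop}

theorem Runs.mono {p : Program} {Q' : ℕ → State → Prop} (h : Runs W D p s Q)
    (hQ : ∀ t s', Q t s' → Q' t s') : Runs W D p s Q' :=
  let ⟨t, s', he, hq⟩ := h
  ⟨t, s', he, hQ t s' hq⟩

theorem Runs.skip (h : Q 1 s) : Runs W D .skip s Q :=
  ⟨_, _, .skip s, h⟩

theorem Runs.assign {x : ℕ} {u : Term}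
    (h : Q (u.cost + 1) ⟨Function.update s.var x (u.eval W s), s.arr⟩) :
    Runs W D (.assign x u) s Q :=
  ⟨_, _, .assign x u s, h⟩

theorem Runs.write {a : ℕ} {i u : Term} (h : Q (i.cost + u.cost + 1)
      ⟨s.var, Function.update s.arr a (Function.update (s.arr a) (i.eval W s) (u.eval W s))⟩) :
    Runs W D (.write a i u) s Q :=
  ⟨_, _, .write a i u s, h⟩

theorem Runs.seq {p q : Program}
    (h : Runs W D p s fun t₁ s₁ => Runs W D q s₁ fun t₂ s₂ => Q (t₁ + t₂) s₂) :
    Runs W D (.seq p q) s Q :=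
  let ⟨_, _, h₁, _, _, h₂, h⟩ := h
  ⟨_, _, .seq h₁ h₂, h⟩

theorem Runs.ite {b : Test} {p q : Program}
    (hp : b.Holds W D s → Runs W D p s fun t s' => Q (b.cost + t + 1) s')
    (hq : ¬ b.Holds W D s → Runs W D q s fun t s' => Q (b.cost + t + 1) s') :
    Runs W D (.ite b p q) s Q := by
  by_cases hb : b.Holds W D s
  · obtain ⟨t, s', he, h⟩ := hp hb
    exact ⟨_, _, .iteTrue hb he, h⟩
  · obtain ⟨t, s', he, h⟩ := hq hb
    exact ⟨_, _, .iteFalse hb he, h⟩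

/-- Total correctness of a loop with invariant `I`, where the potential `Φ` pays for the time. -/
theorem Runs.loop {b : Test} {p : Program} (I : State → Prop) (Φ : State → ℕ)
    (step : ∀ s, I s → b.Holds W D s →
      Runs W D p s fun t s' => I s' ∧ b.cost + t + 1 + Φ s' ≤ Φ s) (hs : I s) :
    Runs W D (.loop b p) s fun t s' => I s' ∧ ¬ b.Holds W D s' ∧ t + Φ s' ≤ Φ s + b.cost + 1 := by
  induction hm : Φ s using Nat.strong_induction_on generalizing s with
  | _ m ih =>
    by_cases hb : b.Holds W D s
    · obtain ⟨t₁, s₁, he₁, hI, hΦ⟩ := step s hs hb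
      obtain ⟨t₂, s₂, he₂, hI₂, hb₂, ht⟩ := ih (Φ s₁) (by omega) hI rfl
      exact ⟨_, _, .loopTrue hb he₁ he₂, hI₂, hb₂, by omega⟩
    · exact ⟨_, _, .loopFalse hb, hs, hb, by omega⟩

end Runs

/-! ### The program -/

/-- The strict comparison of two words. -/
def Test.lt (u v : Term) : Test := .not (.le v u)

/-- The equality of two words. -/
def Test.eq (u v : Term) : Test := .and (.le u v) (.le v u)

/-- The index at which an array holds the entry for the pair of the variables `x` and `y`. -/
def cell (x y : ℕ) : Term := .add (.mul (.var x) (.var 0)) (.var y)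

/-- The test whether `SameSide` holds for the variables `x`, `y` and `z`. -/
def sameSide (x y z : ℕ) : Test :=
  .not (.and (.and (.and
    (.entryLe (.var y) (.var x) (.var y) (.var z))
    (.entryLe (.var x) (.var y) (.var z) (.var y)))
    (.entryLe (.var z) (.var x) (.var z) (.var y)))
    (.entryLe (.var x) (.var z) (.var y) (.var z)))

/-- Label the pair of the variables `9` and `10`, unless it has a label, with the current label
(variable `5`), and append it to the queue (arrays `1` and `2`, of length given by the
variable `4`). The labels are held in the array `0`. -/
def push : Program :=
  .ite (.le (.read 0 (cell 9 10)) (.const 0))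
    (.seq (.write 0 (cell 9 10) (.var 5))
      (.seq (.write 1 (.var 4) (.var 9))
        (.seq (.write 2 (.var 4) (.var 10)) (.assign 4 (.add (.var 4) (.const 1))))))
    .skip

/-- Push those neighbours of the pair of the variables `6` and `7` that are obtained by replacing
one entry by the variable `8`. -/
def pushNeighbours : Program :=
  .seq (.ite (sameSide 6 7 8) (.seq (.assign 9 (.var 6)) (.seq (.assign 10 (.var 8)) push)) .skip)
    (.seq
      (.ite (sameSide 7 6 8) (.seq (.assign 9 (.var 8)) (.seq (.assign 10 (.var 7)) push)) .skip)
      (.assign 8 (.add (.var 8) (.const 1))))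

/-- Push all neighbours of the first pair of the queue that has not yet been processed. -/
def process : Program :=
  .seq (.assign 6 (.read 1 (.var 3))) (.seq (.assign 7 (.read 2 (.var 3)))
    (.seq (.assign 8 (.const 0)) (.seq (.loop (.lt (.var 8) (.var 0)) pushNeighbours)
      (.assign 3 (.add (.var 3) (.const 1))))))

/-- Push the pair of the variables `1` and `2` with a new label, unless it has a label, and let
these variables hold the next pair. -/
def startClass : Program :=
  .seq (.ite (.le (.read 0 (cell 1 2)) (.const 0))
      (.seq (.assign 5 (.add (.var 5) (.const 1)))
        (.seq (.assign 9 (.var 1)) (.seq (.assign 10 (.var 2)) push))) .skip)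
    (.seq (.assign 2 (.add (.var 2) (.const 1)))
      (.ite (.le (.var 0) (.var 2)) (.seq (.assign 1 (.add (.var 1) (.const 1)))
        (.assign 2 (.const 0))) .skip))

/-- Label all pairs by their classes. -/
def labelPairs : Program :=
  .loop (.lt (.var 3) (.mul (.var 0) (.var 0))) (.ite (.lt (.var 3) (.var 4)) process startClass)

/-- Compare the labels of one pair in the queue and of the reversed pair. -/
def checkPair : Program :=
  .seq (.assign 6 (.read 1 (.var 3))) (.seq (.assign 7 (.read 2 (.var 3)))
    (.seq (.ite (.and (.not (.eq (.var 6) (.var 7)))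
        (.eq (.read 0 (cell 6 7)) (.read 0 (cell 7 6)))) (.assign 11 (.const 0)) .skip)
      (.assign 3 (.add (.var 3) (.const 1)))))

/-- Decide whether some pair of distinct elements has the same label as the reversed pair. -/
def checkPairs : Program :=
  .seq (.assign 11 (.const 1)) (.seq (.assign 3 (.const 0))
    (.seq (.loop (.lt (.var 3) (.mul (.var 0) (.var 0))) checkPair) (.assign 0 (.var 11))))

/-! ### Correctness -/

section Correctness

variable {W n : ℕ} {D : Fin n → Fin n → ℝ} {s : State}

theorem cell_lt (p : Fin n × Fin n) : (p.1 : ℕ) * n + p.2 < n * n := by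
  have h₁ : ((p.1 : ℕ) + 1) * n ≤ n * n := Nat.mul_le_mul_right n p.1.2
  have h₂ := p.2.2
  rw [add_mul, one_mul] at h₁
  omega

theorem cell_inj {p q : Fin n × Fin n} : (p.1 : ℕ) * n + p.2 = q.1 * n + q.2 ↔ p = q := by
  refine ⟨fun h => ?_, fun h => h ▸ rfl⟩
  have hn : 0 < n := p.1.pos
  have h₁ := congrArg (· / n) h
  have h₂ := congrArg (· % n) h
  simp only [mul_comm _ n, Nat.mul_add_div hn, Nat.mul_add_mod, Nat.div_eq_of_lt p.2.2,
    Nat.div_eq_of_lt q.2.2, Nat.mod_eq_of_lt p.2.2, Nat.mod_eq_of_lt q.2.2, add_zero] at h₁ h₂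
  exact Prod.ext (Fin.ext h₁) (Fin.ext h₂)

/-- The bound on `W` leaves room for every row-major index, so no arithmetic wraps around. -/
theorem eval_cell (hW : n * n + n + 2 ≤ W) {x y : ℕ} (p : Fin n × Fin n) (h₀ : s.var 0 = n)
    (hx : s.var x = p.1) (hy : s.var y = p.2) : (cell x y).eval W s = p.1 * n + p.2 := by
  have := cell_lt p
  simp only [cell, Term.eval, h₀, hx, hy]
  rw [Nat.mod_eq_of_lt (a := (p.1 : ℕ) * n) (by omega), Nat.mod_eq_of_lt (by omega)]

theorem holds_sameSide {x y z : ℕ} {i j k : Fin n} (hx : s.var x = i) (hy : s.var y = j)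
    (hz : s.var z = k) : (sameSide x y z).Holds W D s ↔ SameSide D i j k := by
  have key : ∀ {a b c e : ℕ} {a' b' c' e' : Fin n}, s.var a = a' → s.var b = b' → s.var c = c' →
      s.var e = e' →
      ((Test.entryLe (.var a) (.var b) (.var c) (.var e)).Holds W D s ↔ D a' b' ≤ D c' e') := by
    intro a b c e a' b' c' e' ha hb hc he
    simp only [Test.Holds, Term.eval, ha, hb, hc, he]
    constructor
    · rintro ⟨_, _, _, _, h₁, h₂, h₃, h₄, h⟩
      rw [← Fin.ext_iff] at h₁ h₂ h₃ h₄
      subst h₁ h₂ h₃ h₄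
      exact h
    · exact fun h => ⟨_, _, _, _, rfl, rfl, rfl, rfl, h⟩
  rw [sameSide, SameSide, ← key hy hx hy hz, ← key hx hy hz hy, ← key hz hx hz hy,
    ← key hx hz hy hz]
  rfl

/-- The labels `L` and the queue `P ++ R`, of which the part `P` has been processed, are held in
the state `s`, and they are as they should be when `c` is the current label. -/
structure Valid (D : Fin n → Fin n → ℝ) (s : State) (L : Fin n × Fin n → ℕ)
    (P R : List (Fin n × Fin n)) (c : ℕ) : Prop where
  size : s.var 0 = n
  tail : s.var 4 = (P ++ R).length
  current : s.var 5 = c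
  label : ∀ p, s.arr 0 (p.1 * n + p.2) = L p
  queue : ∀ i p, (P ++ R)[i]? = some p → s.arr 1 i = p.1 ∧ s.arr 2 i = p.2
  nodup : (P ++ R).Nodup
  mem : ∀ p, p ∈ P ++ R ↔ L p ≠ 0
  le : ∀ p, L p ≤ c
  sound : ∀ p q, L p ≠ 0 → L p = L q → PairEquiv D p q
  complete : ∀ p ∈ P, ∀ q, PairStep D p q → L q = L p
  pending : ∀ p ∈ R, L p = c

namespace Valid

variable {L : Fin n × Fin n → ℕ} {P R : List (Fin n × Fin n)} {c : ℕ}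

theorem congr {s' : State} (h : Valid D s L P R c) (ha : s'.arr = s.arr)
    (h₀ : s'.var 0 = s.var 0) (h₄ : s'.var 4 = s.var 4) (h₅ : s'.var 5 = s.var 5) :
    Valid D s' L P R c :=
  { h with
    size := h₀.trans h.size
    tail := h₄.trans h.tail
    current := h₅.trans h.current
    label := ha ▸ h.label
    queue := ha ▸ h.queue }

theorem length_le (h : Valid D s L P R c) : (P ++ R).length ≤ n * n := by
  simpa using h.nodup.length_le_card

/-- A neighbour that already has a label cannot carry an older one: if it was processed, `complete`
and the symmetry of steps give it the label of `r`. Skipping labelled pairs is thus harmless. -/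
theorem label_eq {r p : Fin n × Fin n} (h : Valid D s L P R c) (hr : r ∈ R) (hp : PairStep D r p)
    (h₀ : L p ≠ 0) : L p = c := by
  rcases List.mem_append.1 ((h.mem p).2 h₀) with hP | hR
  · exact (h.complete p hP r hp.symm).symm.trans (h.pending r hr)
  · exact h.pending p hR

theorem runs_push (hW : n * n + n + 2 ≤ W) (h : Valid D s L P R c) (p : Fin n × Fin n)
    (h₉ : s.var 9 = p.1) (h₁₀ : s.var 10 = p.2) (hc : c ≠ 0)
    (hp : ∀ q, L q = c → PairEquiv D q p) :
    Runs W D push s fun t s' => t ≤ 30 ∧ (∀ i, i ≠ 4 → s'.var i = s.var i) ∧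
      ∃ L' R', Valid D s' L' P (R ++ R') c ∧ L' p ≠ 0 ∧ (∀ q, L q ≠ 0 → L' q = L q) ∧
        (L p = 0 → R' = [p]) := by
  have hcell := eval_cell hW p h.size h₉ h₁₀
  apply Runs.ite
  · intro hb
    have h₀ : L p = 0 := by
      simpa [Test.Holds, Term.eval, hcell, h.label] using hb
    have hnot : p ∉ P ++ R := by rw [h.mem]; exact not_not.2 h₀
    have hnodup : ((P ++ R) ++ [p]).Nodup := by
      rw [List.nodup_append]
      refine ⟨h.nodup, List.nodup_singleton _, ?_⟩
      rintro a ha b hb rfl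
      exact hnot (List.mem_singleton.1 hb ▸ ha)
    -- The queue has no repetitions even after the append, so its new length still fits in a word.
    have hlen : (P ++ R).length + 1 ≤ n * n := by
      simpa [add_assoc, Nat.succ_le_iff] using hnodup.length_le_card
    refine .seq (.write (.seq (.write (.seq (.write (.assign ?_))))))
    refine ⟨by simp [Test.cost, Term.cost, cell], ?_, ?_⟩
    · intro i hi
      simp [hi]
    have h₄ := h.tail
    have h₅ := h.current
    refine ⟨Function.update L p c, [p], ?_, by simpa using hc, ?_, fun _ => rfl⟩
    · constructor
      · simpa using h.size
      · simp only [Term.eval, Function.update_self]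
        rw [h₄, Nat.mod_eq_of_lt (a := 1) (by omega), Nat.mod_eq_of_lt (by omega)]
        simp [add_assoc]
      · simpa using h₅
      · intro q
        simp only [hcell, Term.eval]
        by_cases hq : q = p
        · subst hq
          simp [h₅]
        · have : (q.1 : ℕ) * n + q.2 ≠ p.1 * n + p.2 := fun e => hq (cell_inj.1 e)
          simp [this, hq, h.label]
      · intro i q hq
        rw [← List.append_assoc] at hq
        simp only [Term.eval]
        rcases lt_trichotomy i (P ++ R).length with hi | hi | hi
        · rw [List.getElem?_append_left hi] at hq
          have hne : i ≠ s.var 4 := by omega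
          simpa [hne] using h.queue i q hq
        · subst hi
          have : p = q := by simpa [List.getElem?_append_right] using hq
          subst this
          simp [h₄, h₉, h₁₀]
        · rw [List.getElem?_eq_none (by simp at hi ⊢; omega)] at hq
          cases hq
      · rw [← List.append_assoc]; exact hnodup
      · intro q
        rw [← List.append_assoc, List.mem_append, h.mem, List.mem_singleton]
        by_cases hq : q = p
        · subst hq; simp [hc]
        · simp [hq]
      · intro q
        by_cases hq : q = p
        · subst hq; simp
        · simpa [hq] using h.le q
      · intro q r hq hqr
        by_cases hq' : q = p <;> by_cases hr' : r = p
        · subst hq' hr'; exact .refl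
        · subst hq'
          simp only [Function.update_self, Function.update_of_ne hr'] at hqr
          exact (hp r hqr.symm).symm
        · subst hr'
          simp only [Function.update_self, Function.update_of_ne hq'] at hqr
          exact hp q hqr
        · simp only [Function.update_of_ne hq', Function.update_of_ne hr'] at hq hqr
          exact h.sound q r hq hqr
      · intro q hq r hr
        -- Neighbours of processed pairs are already labelled, so none of them is the new pair `p`.
        have hq₀ : L q ≠ 0 := (h.mem q).1 (List.mem_append_left _ hq)
        have hqp : q ≠ p := fun e => hq₀ (e ▸ h₀)
        have hrp : r ≠ p := fun e => hq₀ (by rw [← h.complete q hq r hr, e, h₀])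
        rw [Function.update_of_ne hqp, Function.update_of_ne hrp]
        exact h.complete q hq r hr
      · intro q hq
        by_cases hqp : q = p
        · subst hqp; simp
        · rw [Function.update_of_ne hqp]
          rcases List.mem_append.1 hq with hq | hq
          · exact h.pending q hq
          · exact absurd (List.mem_singleton.1 hq) hqp
    · intro q hq
      rw [Function.update_of_ne]
      rintro rfl
      exact hq h₀
  · intro hb
    have h₀ : L p ≠ 0 := by
      simpa [Test.Holds, Term.eval, hcell, h.label] using hb
    refine .skip ⟨by simp [Test.cost, Term.cost, cell], fun _ _ => rfl, L, [], by simpa using h,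
      h₀, fun _ _ => rfl, fun h => absurd h h₀⟩

/-- Pushing a neighbour `p` of a pending pair `r`, under a test that ensures that it is one. -/
theorem runs_pushNeighbour (hW : n * n + n + 2 ≤ W) {r p : Fin n × Fin n}
    (h : Valid D s L P R c) (hr : r ∈ R) (hc : c ≠ 0) {b : Test} {x y : ℕ}
    (hb : b.Holds W D s → PairStep D r p) (hx : s.var x = p.1) (hy : s.var y = p.2) (hy₉ : y ≠ 9)
    (hcost : b.cost ≤ 24) :
    Runs W D (.ite b (.seq (.assign 9 (.var x)) (.seq (.assign 10 (.var y)) push)) .skip) s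
      fun t s' => t ≤ 60 ∧ (∀ i, i ≠ 4 → i ≠ 9 → i ≠ 10 → s'.var i = s.var i) ∧
        ∃ L' R', Valid D s' L' P (R ++ R') c ∧ (b.Holds W D s → L' p = c) ∧
          (∀ q, L q ≠ 0 → L' q = L q) := by
  apply Runs.ite
  · intro hb'
    have hstep := hb hb'
    refine .seq (.assign (.seq (.assign ?_)))
    refine (runs_push hW (h.congr ?_ ?_ ?_ ?_) p ?_ ?_ hc ?_).mono ?_
    · rfl
    · simp
    · simp
    · simp
    · simp [Term.eval, hx]
    · simp [Term.eval, hy, hy₉]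
    · intro q hq
      refine (h.sound q r (hq ▸ hc) (hq.trans (h.pending r hr).symm)).tail hstep
    · rintro t s' ⟨ht, hvar, L', R', hv, hp, hL, -⟩
      refine ⟨by simp only [Term.cost]; omega, fun i h₄ h₉ h₁₀ => ?_, L', R', hv, fun _ => ?_, hL⟩
      · rw [hvar i h₄]
        simp [h₉, h₁₀]
      · exact hv.label_eq (List.mem_append_left _ hr) hstep hp
  · intro hb'
    exact .skip ⟨by omega, fun _ _ _ _ => rfl, L, [], by simpa using h,
      fun hs => absurd hs hb', fun _ _ => rfl⟩

end Valid

end Correctness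

end RAM

/-! ### Search steps, labelling and the final check -/

namespace RAM

section Correctness

variable {W n : ℕ} {D : Fin n → Fin n → ℝ} {s : State}

namespace Valid

variable {L : Fin n × Fin n → ℕ} {P R : List (Fin n × Fin n)} {c : ℕ}

theorem runs_pushNeighbours (hW : n * n + n + 2 ≤ W) {r : Fin n × Fin n} {z : Fin n}
    (h : Valid D s L P R c) (hr : r ∈ R) (hc : c ≠ 0) (h₆ : s.var 6 = r.1) (h₇ : s.var 7 = r.2)
    (h₈ : s.var 8 = z) :
    Runs W D pushNeighbours s fun t s' => t ≤ 130 ∧ s'.var 8 = z + 1 ∧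
      (∀ i, i ≠ 4 → i ≠ 8 → i ≠ 9 → i ≠ 10 → s'.var i = s.var i) ∧
      ∃ L' R', Valid D s' L' P (R ++ R') c ∧ (SameSide D r.1 r.2 z → L' (r.1, z) = c) ∧
        (SameSide D r.2 r.1 z → L' (z, r.2) = c) ∧ ∀ q, L q ≠ 0 → L' q = L q := by
  refine .seq ((h.runs_pushNeighbour (p := (r.1, z)) hW hr hc ?_ h₆ h₈ (by norm_num)
    (by simp [sameSide, Test.cost, Term.cost])).mono ?_)
  · rw [holds_sameSide h₆ h₇ h₈]
    exact .right
  rw [holds_sameSide h₆ h₇ h₈]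
  rintro t₁ s₁ ⟨ht₁, hv₁, L₁, R₁, h, hs₁, hL₁⟩
  have h₆ : s₁.var 6 = r.1 := by rw [hv₁ 6 (by norm_num) (by norm_num) (by norm_num), h₆]
  have h₇ : s₁.var 7 = r.2 := by rw [hv₁ 7 (by norm_num) (by norm_num) (by norm_num), h₇]
  have h₈ : s₁.var 8 = z := by rw [hv₁ 8 (by norm_num) (by norm_num) (by norm_num), h₈]
  refine .seq ((h.runs_pushNeighbour (p := (z, r.2)) hW (List.mem_append_left _ hr) hc ?_ h₈ h₇
    (by norm_num) (by simp [sameSide, Test.cost, Term.cost])).mono ?_)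
  · rw [holds_sameSide h₇ h₆ h₈]
    exact .left
  rw [holds_sameSide h₇ h₆ h₈]
  rintro t₂ s₂ ⟨ht₂, hv₂, L₂, R₂, h, hs₂, hL₂⟩
  have h₈ : s₂.var 8 = z := by rw [hv₂ 8 (by norm_num) (by norm_num) (by norm_num), h₈]
  have hz := z.2
  refine .assign ⟨by simp only [Term.cost]; omega, ?_, ?_, L₂, R₁ ++ R₂, ?_, ?_, hs₂, ?_⟩
  · simp only [Term.eval, h₈, Function.update_self]
    rw [Nat.mod_eq_of_lt (a := 1) (by omega), Nat.mod_eq_of_lt (by omega)]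
  · intro i i₄ i₈ i₉ i₁₀
    simp [i₈, hv₂ i i₄ i₉ i₁₀, hv₁ i i₄ i₉ i₁₀]
  · rw [← List.append_assoc]
    exact h.congr rfl (by simp) (by simp) (by simp)
  · intro hs
    have := hs₁ hs
    rw [hL₂ _ (this ▸ hc), this]
  · intro q hq
    rw [hL₂ q (hL₁ q hq ▸ hq), hL₁ q hq]

/-- Moving the head from pending to processed only requires `complete` for that pair. -/
theorem pop {r : Fin n × Fin n} (h : Valid D s L P (r :: R) c)
    (hr : ∀ q, PairStep D r q → L q = c) : Valid D s L (P ++ [r]) R c := by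
  have e : P ++ [r] ++ R = P ++ r :: R := by simp
  exact
    { h with
      tail := e ▸ h.tail
      queue := e ▸ h.queue
      nodup := e ▸ h.nodup
      mem := e ▸ h.mem
      complete := by
        intro p hp q hq
        rcases List.mem_append.1 hp with hp | hp
        · exact h.complete p hp q hq
        · obtain rfl := List.mem_singleton.1 hp
          exact (hr q hq).trans (h.pending p List.mem_cons_self).symm
      pending := fun p hp => h.pending p (List.mem_cons_of_mem _ hp) }

theorem runs_process (hW : n * n + n + 2 ≤ W) {r : Fin n × Fin n}
    (h : Valid D s L P (r :: R) c) (hc : c ≠ 0) (h₃ : s.var 3 = P.length) :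
    Runs W D process s fun t s' => t ≤ 140 * n + 100 ∧ s'.var 3 = P.length + 1 ∧
      s'.var 1 = s.var 1 ∧ s'.var 2 = s.var 2 ∧
      ∃ L' R', Valid D s' L' (P ++ [r]) (R ++ R') c ∧ ∀ q, L q ≠ 0 → L' q = L q := by
  have hr := h.queue P.length r (by simp)
  refine .seq (.assign (.seq (.assign (.seq (.assign (.seq ?_))))))
  -- The pair `r` stays pending during the scan; the last clause records that the neighbours
  -- obtained from third elements `z` below the counter have the current label.
  refine (Runs.loop (fun s' => s'.var 1 = s.var 1 ∧ s'.var 2 = s.var 2 ∧ s'.var 3 = P.length ∧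
    s'.var 6 = r.1 ∧ s'.var 7 = r.2 ∧ s'.var 8 ≤ n ∧
    ∃ L' R', Valid D s' L' P (r :: (R ++ R')) c ∧ (∀ q, L q ≠ 0 → L' q = L q) ∧
      ∀ z : Fin n, (z : ℕ) < s'.var 8 → (SameSide D r.1 r.2 z → L' (r.1, z) = c) ∧
        (SameSide D r.2 r.1 z → L' (z, r.2) = c)) (fun s' => (n - s'.var 8) * 140)
    ?_ ?_).mono ?_
  · rintro s₁ ⟨h₁, h₂, h₃, h₆, h₇, h₈, L₁, R₁, h, hL, hz⟩ hb
    have hlt : s₁.var 8 < n := by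
      simpa [Test.lt, Test.Holds, Term.eval, h.size] using hb
    refine (h.runs_pushNeighbours (z := ⟨s₁.var 8, hlt⟩) hW List.mem_cons_self hc h₆ h₇ rfl).mono ?_
    rintro t s₂ ⟨ht, h₈', hv, L₂, R₂, h', hs, hs', hL'⟩
    have hv' : ∀ i, i ≤ 3 ∨ i = 6 ∨ i = 7 → s₂.var i = s₁.var i := fun i hi =>
      hv i (by omega) (by omega) (by omega) (by omega)
    rw [hv' 1 (by norm_num), hv' 2 (by norm_num), hv' 3 (by norm_num), hv' 6 (by norm_num),
      hv' 7 (by norm_num), h₈']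
    refine ⟨⟨h₁, h₂, h₃, h₆, h₇, hlt, L₂, R₁ ++ R₂, by simpa using h', ?_, ?_⟩, ?_⟩
    · intro q hq
      rw [hL' q (hL q hq ▸ hq), hL q hq]
    · intro z hz'
      rcases Nat.lt_succ_iff_lt_or_eq.1 hz' with hlt' | heq
      · obtain ⟨hz₁, hz₂⟩ := hz z hlt'
        refine ⟨fun hst => ?_, fun hst => ?_⟩
        · rw [hL' _ (hz₁ hst ▸ hc), hz₁ hst]
        · rw [hL' _ (hz₂ hst ▸ hc), hz₂ hst]
      · obtain rfl : z = ⟨s₁.var 8, hlt⟩ := Fin.ext heq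
        exact ⟨hs, hs'⟩
    · simp only [Test.lt, Test.cost, Term.cost]
      omega
  · refine ⟨by simp, by simp, by simpa using h₃, by simpa [Term.eval, h₃] using hr.1,
      by simpa [Term.eval, h₃] using hr.2, by simp [Term.eval], L, [],
      by rw [List.append_nil]; exact h.congr rfl (by simp) (by simp) (by simp), fun _ _ => rfl,
      fun z hz => ?_⟩
    simp [Term.eval] at hz
  · rintro t s₁ ⟨⟨h₁, h₂, h₃, -, -, -, L₁, R₁, h', hL, hz⟩, hb, ht⟩
    have hge : n ≤ s₁.var 8 := by
      simpa [Test.lt, Test.Holds, Term.eval, h'.size] using hb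
    have hlen := h'.length_le
    rw [List.length_append, List.length_cons] at hlen
    refine .assign ⟨?_, ?_, by simpa using h₁, by simpa using h₂, L₁, R₁, ?_, hL⟩
    · simp [Term.eval, Test.lt, Test.cost, Term.cost] at ht ⊢
      omega
    · simp only [Term.eval, h₃, Function.update_self]
      rw [Nat.mod_eq_of_lt (a := 1) (by omega), Nat.mod_eq_of_lt (by omega)]
    · have h' := h'.pop (fun q hq => ?_)
      · exact h'.congr rfl (by simp) (by simp) (by simp)
      · cases hq with
        | right hq => exact (hz _ (Fin.is_lt _ |>.trans_le hge)).1 hq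
        | left hq => exact (hz _ (Fin.is_lt _ |>.trans_le hge)).2 hq

/-- A repetition-free queue of length `n²` lists every pair. -/
theorem eq_of_length {p : Fin n × Fin n} (h : Valid D s L P R c) (hp : n * n ≤ (P ++ R).length) :
    L p ≠ 0 := by
  rw [← h.mem]
  have hcard := List.toFinset_card_of_nodup h.nodup
  have : (P ++ R).toFinset = Finset.univ := by
    rw [← Finset.card_eq_iff_eq_univ, hcard]
    exact le_antisymm (by simpa using h.length_le) (by simpa using hp)
  rw [← List.mem_toFinset, this]
  exact Finset.mem_univ p

/-- With nothing pending, every class met so far is closed, so a fresh label may be introduced. The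
bound of labels by the queue length keeps them from wrapping around. -/
theorem runs_startClass (hW : n * n + n + 2 ≤ W) (h : Valid D s L P [] c) (hc : c ≤ P.length)
    (h₁ : s.var 1 < n) (h₂ : s.var 2 < n)
    (hL : ∀ p : Fin n × Fin n, (p.1 : ℕ) * n + p.2 < s.var 1 * n + s.var 2 → L p ≠ 0) :
    Runs W D startClass s fun t s' => t ≤ 100 ∧ s'.var 3 = s.var 3 ∧
      s'.var 1 ≤ n ∧ s'.var 2 < n ∧ s'.var 1 * n + s'.var 2 = s.var 1 * n + s.var 2 + 1 ∧
      ∃ L' R' c', Valid D s' L' P R' c' ∧ c' ≤ (P ++ R').length ∧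
        ∀ p : Fin n × Fin n, (p.1 : ℕ) * n + p.2 < s'.var 1 * n + s'.var 2 → L' p ≠ 0 := by
  have hcell := eval_cell hW (⟨s.var 1, h₁⟩, ⟨s.var 2, h₂⟩) h.size rfl rfl
  have hlen := h.length_le
  have hidx := cell_lt (⟨s.var 1, h₁⟩, ⟨s.var 2, h₂⟩)
  simp only [List.append_nil] at hcell hlen hidx
  -- Advancing the row-major cursor is common to both branches of the test.
  have key : ∀ {s₁ : State} {t₁ : ℕ} {L' R' c'}, t₁ ≤ 70 → s₁.var 1 = s.var 1 →
      s₁.var 2 = s.var 2 → s₁.var 3 = s.var 3 → Valid D s₁ L' P R' c' →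
      c' ≤ (P ++ R').length → (∀ p : Fin n × Fin n, L p ≠ 0 → L' p ≠ 0) →
      L' (⟨s.var 1, h₁⟩, ⟨s.var 2, h₂⟩) ≠ 0 →
      Runs W D (.seq (.assign 2 (.add (.var 2) (.const 1)))
        (.ite (.le (.var 0) (.var 2)) (.seq (.assign 1 (.add (.var 1) (.const 1)))
          (.assign 2 (.const 0))) .skip)) s₁ fun t s' => t₁ + t ≤ 100 ∧ s'.var 3 = s.var 3 ∧
      s'.var 1 ≤ n ∧ s'.var 2 < n ∧ s'.var 1 * n + s'.var 2 = s.var 1 * n + s.var 2 + 1 ∧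
      ∃ L' R' c', Valid D s' L' P R' c' ∧ c' ≤ (P ++ R').length ∧
        ∀ p : Fin n × Fin n, (p.1 : ℕ) * n + p.2 < s'.var 1 * n + s'.var 2 → L' p ≠ 0 := by
    intro s₁ t₁ L' R' c' ht e₁ e₂ e₃ hv hc' hLL hL'
    have hnew : ∀ p : Fin n × Fin n, (p.1 : ℕ) * n + p.2 < s.var 1 * n + s.var 2 + 1 →
        L' p ≠ 0 := by
      intro p hp
      rcases Nat.lt_succ_iff_lt_or_eq.1 hp with hp | hp
      · exact hLL p (hL p hp)
      · obtain rfl := cell_inj (q := (⟨s.var 1, h₁⟩, ⟨s.var 2, h₂⟩)).1 hp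
        exact hL'
    have he : ((Term.var 2).add (.const 1)).eval W s₁ = s.var 2 + 1 := by
      simp only [Term.eval, e₂]
      rw [Nat.mod_eq_of_lt (a := 1) (by omega), Nat.mod_eq_of_lt (by omega)]
    refine .seq (.assign (.ite (fun hb => ?_) fun hb => ?_))
    · have hb : n ≤ s.var 2 + 1 := by
        rw [he] at hb
        simpa [Test.Holds, Term.eval, hv.size] using hb
      have hadd : s.var 2 + 1 = n := by omega
      refine .seq (.assign (.assign ⟨?_, by simpa using e₃, ?_, ?_, ?_, L', R', c',
        hv.congr rfl (by simp) (by simp) (by simp), hc', ?_⟩))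
      · simp only [Test.cost, Term.cost]; omega
      all_goals
        simp only [Term.eval, Function.update_self, ne_eq,
          not_false_eq_true, Function.update_of_ne, OfNat.one_ne_ofNat, e₁, Nat.zero_mod,
          Nat.mod_eq_of_lt (show 1 < W by omega), Nat.mod_eq_of_lt (show s.var 1 + 1 < W by omega),
          add_mul, one_mul, add_zero]
      · omega
      · omega
      · omega
      · intro p hp
        exact hnew p (by omega)
    · have hb : s.var 2 + 1 < n := by
        rw [he] at hb
        simpa [Test.Holds, Term.eval, hv.size] using hb
      refine .skip ⟨?_, by simpa using e₃, by simpa [e₁] using h₁.le, ?_, ?_, L', R', c',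
        hv.congr rfl (by simp) (by simp) (by simp), hc', ?_⟩
      · simp only [Test.cost, Term.cost]; omega
      all_goals
        simp only [he, Function.update_self, ne_eq, OfNat.one_ne_ofNat, not_false_eq_true,
          Function.update_of_ne, e₁]
      · omega
      · omega
      · exact hnew
  refine .seq (.ite (fun hb => ?_) fun hb => ?_)
  · have h₀ : L (⟨s.var 1, h₁⟩, ⟨s.var 2, h₂⟩) = 0 := by
      simpa [Test.Holds, Term.eval, hcell, ← h.label] using hb
    have hlt : P.length < n * n := by
      refine lt_of_not_ge fun hge => h.eq_of_length (by simpa using hge) h₀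
    have h₅ := h.current
    refine .seq (.assign (.seq (.assign (.seq (.assign ?_)))))
    have h' : Valid D ⟨Function.update s.var 5 (((Term.var 5).add (.const 1)).eval W s), s.arr⟩
        L P [] (c + 1) :=
      { h with
        size := by simpa using h.size
        tail := by simpa using h.tail
        current := by
          simp only [Term.eval, h₅, Function.update_self]
          rw [Nat.mod_eq_of_lt (a := 1) (by omega), Nat.mod_eq_of_lt (by omega)]
        le := fun p => (h.le p).trans (Nat.le_succ c)
        pending := by simp }
    refine (runs_push hW (h'.congr ?_ ?_ ?_ ?_) (⟨s.var 1, h₁⟩, ⟨s.var 2, h₂⟩) ?_ ?_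
      c.succ_ne_zero ?_).mono ?_
    · rfl
    · simp
    · simp
    · simp
    · simp [Term.eval]
    · simp [Term.eval]
    · intro q hq
      have := h.le q
      omega
    · rintro t s₁ ⟨ht, hv, L', R', h'', hL', hmono, hR'⟩
      -- The start of a class really enqueues a pair, so the queue length grows along with the
      -- label.
      obtain rfl := hR' h₀
      refine key ?_ ?_ ?_ ?_ h'' ?_ (fun p hp => by rwa [hmono p hp]) hL'
      · simp only [Test.cost, Term.cost, cell]; omega
      · rw [hv 1 (by norm_num)]; simp
      · rw [hv 2 (by norm_num)]; simp
      · rw [hv 3 (by norm_num)]; simp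
      · simpa using hc
  · have h₀ : L (⟨s.var 1, h₁⟩, ⟨s.var 2, h₂⟩) ≠ 0 := by
      simpa [Test.Holds, Term.eval, hcell, ← h.label] using hb
    exact .skip (key (by simp [Test.cost, Term.cost, cell]) rfl rfl rfl h (by simpa using hc)
      (fun _ h => h) h₀)

end Valid

/-- Each iteration either processes a pair, at linear cost, or advances the cursor, at constant
cost. Each happens at most `n²` times, which the two summands of the potential pay for. -/
theorem runs_labelPairs (hW : n * n + n + 2 ≤ W) :
    Runs W D labelPairs (initialState n) fun t s' => t ≤ n * n * (140 * n + 150) + n * n * 150 + 10 ∧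
      ∃ L P c, Valid D s' L P [] c ∧ P.length = n * n := by
  refine (Runs.loop (fun s => s.var 1 ≤ n ∧ (0 < n → s.var 2 < n) ∧ ∃ L P R c, Valid D s L P R c ∧
    s.var 3 = P.length ∧ c ≤ (P ++ R).length ∧
    ∀ p : Fin n × Fin n, (p.1 : ℕ) * n + p.2 < s.var 1 * n + s.var 2 → L p ≠ 0)
    (fun s => (n * n - s.var 3) * (140 * n + 150) + (n * n - (s.var 1 * n + s.var 2)) * 150)
    ?_ ?_).mono ?_
  · rintro s ⟨h₁, h₂, L, P, R, c, h, h₃, hc, hL⟩ hb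
    have hlt : s.var 3 < n * n := by
      simpa [Test.lt, Test.Holds, Term.eval, h.size, Nat.mod_eq_of_lt (show n * n < W by omega)]
        using hb
    apply Runs.ite
    · intro hb'
      cases R with
      | nil => simp [Test.lt, Test.Holds, Term.eval, h₃, h.tail] at hb'
      | cons r R =>
        have hc₀ : c ≠ 0 := by
          rw [← h.pending r List.mem_cons_self, ← h.mem]
          simp
        refine (h.runs_process hW hc₀ h₃).mono ?_
        rintro t s' ⟨ht, h₃', h₁', h₂', L', R', h', hL'⟩
        refine ⟨⟨h₁'.trans_le h₁, fun hn => h₂'.trans_lt (h₂ hn), L', P ++ [r], R ++ R', c, h',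
          by simpa using h₃', ?_, ?_⟩, ?_⟩
        · simp only [List.length_append, List.length_cons] at hc ⊢
          omega
        · intro p hp
          rw [h₁', h₂'] at hp
          rw [hL' p (hL p hp)]
          exact hL p hp
        · rw [h₁', h₂', h₃', ← h₃]
          obtain ⟨m, hm⟩ : ∃ m, n * n - s.var 3 = m + 1 := ⟨n * n - s.var 3 - 1, by omega⟩
          have hm' : n * n - (s.var 3 + 1) = m := by omega
          rw [hm, hm', add_mul]
          simp only [Test.lt, Test.cost, Term.cost]
          omega
    · intro hb'
      have hR : R = [] := by
        have hb'' : s.var 4 ≤ s.var 3 := by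
          simpa [Test.lt, Test.Holds, Term.eval] using hb'
        rw [h₃, h.tail, List.length_append] at hb''
        exact List.length_eq_zero_iff.1 (by omega)
      subst hR
      have hn : 0 < n := Nat.pos_of_ne_zero fun e => by simp [e] at hlt
      have h₂ := h₂ hn
      -- A cursor past the last row would mean that all pairs are labelled, hence processed,
      -- contrary to the loop test.
      have h₁ : s.var 1 < n := by
        refine lt_of_le_of_ne h₁ fun e => ?_
        have : (Finset.univ : Finset (Fin n × Fin n)) ⊆ (P ++ []).toFinset := by
          intro p _
          rw [List.mem_toFinset, h.mem]
          apply hL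
          rw [e]
          exact (cell_lt p).trans_le (Nat.le_add_right _ _)
        have := (Finset.card_le_card this).trans (List.toFinset_card_le _)
        simp at this
        omega
      have hidx := cell_lt (⟨s.var 1, h₁⟩, ⟨s.var 2, h₂⟩)
      refine (h.runs_startClass hW (by simpa using hc) h₁ h₂ hL).mono ?_
      rintro t s' ⟨ht, h₃', h₁', h₂', hidx', L', R', c', h', hc', hL'⟩
      refine ⟨⟨h₁', fun _ => h₂', L', P, R', c', h', h₃'.trans h₃, hc', hL'⟩, ?_⟩
      rw [h₃', hidx']
      simp only [Test.lt, Test.cost, Term.cost] at *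
      omega
  · refine ⟨Nat.zero_le _, fun hn => hn, fun _ => 0, [], [], 0, ?_, rfl, le_rfl, ?_⟩
    · constructor <;> simp [initialState]
    · intro p hp
      simp [initialState] at hp
  · rintro t s ⟨⟨-, -, L, P, R, c, h, h₃, -, -⟩, hb, ht⟩
    have hle : n * n ≤ P.length := by
      simpa [Test.lt, Test.Holds, Term.eval, h.size, h₃,
        Nat.mod_eq_of_lt (show n * n < W by omega)] using hb
    have hlen := h.length_le
    rw [List.length_append] at hlen
    obtain rfl : R = [] := List.length_eq_zero_iff.1 (by omega)
    refine ⟨?_, L, P, c, h, by simp at hlen; omega⟩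
    simp [initialState, Test.lt, Test.cost, Term.cost] at ht
    omega

/-- With all pairs processed, equal labels mean equal classes. The exhausted queue doubles as an
enumeration of the pairs. -/
theorem Valid.runs_checkPairs {L : Fin n × Fin n → ℕ} {P : List (Fin n × Fin n)} {c : ℕ}
    (hW : n * n + n + 2 ≤ W) (h : Valid D s L P [] c) (hP : P.length = n * n) :
    Runs W D checkPairs s fun t s' => t ≤ n * n * 60 + 20 ∧
      ((∀ x y, x ≠ y → ¬ PairEquiv D (x, y) (y, x)) → s'.var 0 = 1) ∧
      (¬ (∀ x y, x ≠ y → ¬ PairEquiv D (x, y) (y, x)) → s'.var 0 = 0) := by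
  have hmem : ∀ p, p ∈ P := fun p => by
    have := h.eq_of_length (p := p) (by simp [hP])
    rwa [← h.mem, List.append_nil] at this
  have hclass : ∀ p q, PairEquiv D p q ↔ L p = L q := by
    intro p q
    constructor
    · intro hpq
      induction hpq with
      | refl => rfl
      | tail _ hq ih => exact ih.trans (h.complete _ (hmem _) _ hq).symm
    · exact h.sound p q (h.eq_of_length (by simp [hP]))
  simp only [hclass]
  refine .seq (.assign (.seq (.assign (.seq ?_))))
  -- Either a reversed pair has been found, or none occurs among the queue entries inspected so far.
  refine (Runs.loop (fun s => Valid D s L P [] c ∧ s.var 3 ≤ n * n ∧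
    (s.var 11 = 0 ∧ (∃ x y, x ≠ y ∧ L (x, y) = L (y, x)) ∨ s.var 11 = 1 ∧
      ∀ i p, i < s.var 3 → P[i]? = some p → p.1 ≠ p.2 → L p ≠ L p.swap))
    (fun s => (n * n - s.var 3) * 60) ?_ ?_).mono ?_
  · rintro s ⟨h, h₃, hans⟩ hb
    have hlt : s.var 3 < n * n := by
      simpa [Test.lt, Test.Holds, Term.eval, h.size, Nat.mod_eq_of_lt (show n * n < W by omega)]
        using hb
    obtain ⟨p, hp⟩ : ∃ p, P[s.var 3]? = some p := ⟨_, List.getElem?_eq_getElem (by omega)⟩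
    have hq := h.queue (s.var 3) p (by simpa using hp)
    refine .seq (.assign (.seq (.assign (.seq ?_))))
    set s₁ : State := ⟨Function.update (Function.update s.var 6 _) 7 _, _⟩ with hs₁
    have h₆ : s₁.var 6 = p.1 := by simpa [hs₁, Term.eval] using hq.1
    have h₇ : s₁.var 7 = p.2 := by simpa [hs₁, Term.eval] using hq.2
    have h₃' : s₁.var 3 = s.var 3 := by simp [hs₁]
    have h₁₁ : s₁.var 11 = s.var 11 := by simp [hs₁]
    have hv : Valid D s₁ L P [] c := h.congr rfl (by simp [hs₁]) (by simp [hs₁]) (by simp [hs₁])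
    have hc₁ := eval_cell hW p hv.size h₆ h₇
    have hc₂ := eval_cell hW p.swap hv.size h₇ h₆
    have htest : (Test.and (.not (.eq (.var 6) (.var 7)))
        (.eq (.read 0 (cell 6 7)) (.read 0 (cell 7 6)))).Holds W D s₁ ↔
        p.1 ≠ p.2 ∧ L p = L p.swap := by
      have hl₁ := hv.label p
      have hl₂ := hv.label p.swap
      simp only [Test.Holds, Test.eq, Term.eval, hc₁, hc₂, hl₁, hl₂, h₆, h₇, ← le_antisymm_iff,
        ← Fin.ext_iff, ne_eq]
    have key : ∀ {s₂ : State} {t : ℕ}, t ≤ 40 → s₂.var 3 = s.var 3 → Valid D s₂ L P [] c →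
        (s₂.var 11 = 0 ∧ (∃ x y, x ≠ y ∧ L (x, y) = L (y, x)) ∨ s₂.var 11 = 1 ∧
          ∀ i p, i < s.var 3 + 1 → P[i]? = some p → p.1 ≠ p.2 → L p ≠ L p.swap) →
        Runs W D (.assign 3 (.add (.var 3) (.const 1))) s₂ fun t' s' =>
          (Valid D s' L P [] c ∧ s'.var 3 ≤ n * n ∧
            (s'.var 11 = 0 ∧ (∃ x y, x ≠ y ∧ L (x, y) = L (y, x)) ∨ s'.var 11 = 1 ∧
              ∀ i p, i < s'.var 3 → P[i]? = some p → p.1 ≠ p.2 → L p ≠ L p.swap)) ∧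
          (Test.lt (.var 3) (.mul (.var 0) (.var 0))).cost +
            (((Term.var 3).read 1).cost + 1 + (((Term.var 3).read 2).cost + 1 + (t + t'))) + 1 +
            (n * n - s'.var 3) * 60 ≤ (n * n - s.var 3) * 60 := by
      intro s₂ t ht e hv hans
      have he : ((Term.var 3).add (.const 1)).eval W s₂ = s.var 3 + 1 := by
        simp only [Term.eval, e]
        rw [Nat.mod_eq_of_lt (a := 1) (by omega), Nat.mod_eq_of_lt (by omega)]
      refine .assign ?_
      simp only [he, Function.update_self]
      refine ⟨⟨hv.congr rfl (by simp) (by simp) (by simp), hlt, by simpa using hans⟩, ?_⟩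
      simp only [Test.lt, Test.cost, Term.cost]
      omega
    refine .ite (fun hb => ?_) fun hb => ?_
    · obtain ⟨hne, heq⟩ := htest.1 hb
      refine .assign (key (by simp [Test.eq, Test.cost, Term.cost, cell]) (by simpa using h₃')
        (hv.congr rfl (by simp) (by simp) (by simp)) (.inl ⟨by simp [Term.eval], _, _, hne, heq⟩))
    · rw [htest] at hb
      refine .skip (key (by simp [Test.eq, Test.cost, Term.cost, cell]) h₃' hv ?_)
      rw [h₁₁]
      refine hans.imp_right fun ⟨h1, h2⟩ => ⟨h1, fun i q hi hq => ?_⟩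
      rcases Nat.lt_succ_iff_lt_or_eq.1 hi with hi | rfl
      · exact h2 i q hi hq
      · obtain rfl : p = q := Option.some.inj (hp.symm.trans hq)
        exact fun hne heq => hb ⟨hne, heq⟩
  · refine ⟨h.congr rfl (by simp) (by simp) (by simp), by simp [Term.eval], .inr ⟨?_, ?_⟩⟩
    · simp [Term.eval, Nat.mod_eq_of_lt (show 1 < W by omega)]
    · intro i p hi
      simp [Term.eval] at hi
  · rintro t s ⟨⟨h, h₃, hans⟩, hb, ht⟩
    have hge : n * n ≤ s.var 3 := by
      simpa [Test.lt, Test.Holds, Term.eval, h.size, Nat.mod_eq_of_lt (show n * n < W by omega)]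
        using hb
    refine .assign ⟨?_, ?_⟩
    · simp [Term.eval, Test.lt, Test.cost, Term.cost] at ht ⊢
      omega
    · simp only [Term.eval, Function.update_self]
      rcases hans with ⟨h0, x, y, hne, heq⟩ | ⟨h1, hall⟩
      · exact ⟨fun hn => absurd heq (hn x y hne), fun _ => h0⟩
      · refine ⟨fun _ => h1, fun hn => absurd (fun x y hne => ?_) hn⟩
        obtain ⟨i, hi⟩ := List.mem_iff_getElem?.1 (hmem (x, y))
        have hi' := (List.getElem?_eq_some_iff.1 hi).1
        exact hall i (x, y) (by omega) hi hne

end Correctness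

end RAM

/-! ### The decision theorem -/

theorem mainTheorem3 :
    ∃ (p : RAM.Program) (w C : ℕ), ∀ (X : Type*) [Fintype X] (d : X → X → ℝ), IsDissimilarity d →
      ∀ e : Fin (Fintype.card X) ≃ X,
        RAM.DecidesWithin p w (fun i j => d (e i) (e j)) (C * (Fintype.card X ^ 3 + 1))
          (IsTwoWayRobinson d) := by
  -- Words below `(n + 2) ^ 2` hold all indices and labels. The two phases cost at most `140 * n ^ 3
  -- + 360 * n ^ 2 + 30`, which `600 * (n ^ 3 + 1)` dominates.
  refine ⟨.seq RAM.labelPairs RAM.checkPairs, 1, 600, fun X _ d hd e => ?_⟩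
  generalize hn : Fintype.card X = n at e
  have hrob : IsTwoWayRobinson d ↔ ∀ x y, x ≠ y →
      ¬ PairEquiv (fun i j => d (e i) (e j)) (x, y) (y, x) := by
    rw [isTwoWayRobinson_iff_pairEquiv hd]
    exact ⟨fun h x y hxy hp => h (e x) (e y) (e.injective.ne hxy) (PairEquiv.map e hp),
      fun h x y hxy hp => h (e.symm x) (e.symm y) (e.symm.injective.ne hxy)
        ((pairEquiv_map_iff e).1 (by simpa using hp))⟩
  have hW : n * n + n + 2 ≤ (n + 2) ^ (1 + 1) := by
    rw [one_add_one_eq_two, sq]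
    ring_nf
    omega
  obtain ⟨t, s, he, ht, h⟩ := RAM.Runs.seq
    (Q := fun t s => t ≤ 600 * (n ^ 3 + 1) ∧
      ((∀ x y, x ≠ y → ¬ PairEquiv (fun i j => d (e i) (e j)) (x, y) (y, x)) → s.var 0 = 1) ∧
      (¬ (∀ x y, x ≠ y → ¬ PairEquiv (fun i j => d (e i) (e j)) (x, y) (y, x)) → s.var 0 = 0))
    ((RAM.runs_labelPairs hW).mono fun t s ⟨ht, L, P, c, hv, hP⟩ =>
      (hv.runs_checkPairs hW hP).mono fun t' s' ⟨ht', h⟩ => ⟨by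
        have : n * n ≤ n ^ 3 := by
          rw [← sq]
          rcases Nat.eq_zero_or_pos n with rfl | hn
          · rfl
          · exact Nat.pow_le_pow_right hn (by norm_num)
        have e₁ : n * n * (140 * n + 150) = 140 * n ^ 3 + 150 * (n * n) := by ring
        omega, h⟩)
  rw [← hrob] at h
  exact ⟨t, s, he, ht, h⟩
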